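/- Let $\mathsf X$ be a category (possibly large; "small" means small relative to the universe of the hom-sets of $\mathsf X$). Let $\mathsf{Cat}/\mathsf X$ be the category whose objects are pairs $(\mathsf J,D)$ of a small category $\mathsf J$ and a functor $D\colon \mathsf J\to\mathsf X$, and whose morphisms $(\mathsf J,D)\to(\mathsf K,E)$ are functors $R\colon\mathsf J\to\mathsf K$ with $E R=D$. Let $\mathsf{Diag}_\leftarrow(\mathsf X)$ be the category with the same objects, whose morphisms $(\mathsf J,D)\to(\mathsf K,E)$ are pairs $(R,\rho)$ of a functor $R\colon\mathsf K\to\mathsf J$ and a natural transformation $\rho\colon D R\Rightarrow E$, with composition $(S,\sigma)\circ(R,\rho)=(R S,\ \sigma\cdot\rho S)$. The inclusion $i\colon(\mathsf{Cat}/\mathsf X)^{\mathrm{op}}\to\mathsf{Diag}_\leftarrow(\mathsf X)$ is the identity on objects and sends $R$ to $(R,\mathrm{id})$. A functor $\pi\colon\mathsf E\to\mathsf X$ is a discrete opfibration if for all $f\colon x\to y$ in $\mathsf X$ and all $\bar x\in\mathsf E$ with $\pi\bar x=x$ there is a unique pair of an object $\bar y$ and a morphism $\bar f\colon\bar x\to\bar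 y$ with $\pi\bar f=f$. For a diagram $D\colon \mathsf J\to\mathsf X$ let $\mathrm{Lift}(D,\pi)$ be the set of functors $\bar D\colon \mathsf J\to\mathsf E$ with $\pi\bar D=D$. A morphism $(R,\rho)\colon(\mathsf J,D)\to(\mathsf K,E)$ of $\mathsf{Diag}_\leftarrow(\mathsf X)$ induces, for every discrete opfibration $\pi$, a map $\mathrm{Lift}(D,\pi)\to\mathrm{Lift}(E,\pi)$, sending $\bar D$ to the unique lift $\bar E$ of $E$ whose value at each $k\in\mathsf K$ is the codomain of the unique lift of $\rho_k\colon DR(k)\to E(k)$ with domain $\bar D R(k)$. Call $(R,\rho)$ a weak equivalence if this map is a bijection for every discrete opfibration $\pi$ over $\mathsf X$, and let $\mathcal W_\leftarrow$ be the class of weak equivalences. Let $\mathcal N$ be the class of morphisms $R\colon(\mathsf J,D)\to(\mathsf K,E)$ of $\mathsf{Cat}/\mathsf X$ for which the functor $R$ is initial, i.e. for every $k\in\mathsf K$ the comma category $R/k$ is non-empty and connected. Theorem. 1. Let $Q\colon\mathsf{Diag}_\leftarrow(\mathsf X)\to\mathsf{Diag}_\leftarrow(\mathsf X)[\mathcal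 W_\leftarrow^{-1}]$ be the localisation functor. Then $Q\circ i$ inverts $\mathcal N$, and the induced functor $$(\mathsf{Cat}/\mathsf X)^{\mathrm{op}}[\mathcal N^{-1}]\longrightarrow\mathsf{Diag}_\leftarrow(\mathsf X)[\mathcal W_\leftarrow^{-1}]$$ is an isomorphism of categories. 2. Consequently, if $\mathsf X$ is small, the restriction of $Q\circ i$ to the opposite of the full subcategory of $\mathsf{Cat}/\mathsf X$ spanned by the discrete opfibrations is an equivalence of categories onto $\mathsf{Diag}_\leftarrow(\mathsf X)[\mathcal W_\leftarrow^{-1}]$. -/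

import Mathlib

open CategoryTheory Opposite

universe v u v₁ u₁ v₂ u₂ v₃ u₃

namespace DiagLoc

/-! ### Discrete opfibrations and lifts -/

section DiscreteOpfibrations

variable {X : Type u} [Category.{v} X] {A : Type u₁} [Category.{v₁} A]

/-- `π : A ⥤ X` is a discrete opfibration at `f : x ⟶ y` if every object over `x` is the domain of
exactly one morphism over `f`; the codomain is part of what is unique. -/
def IsDiscreteOpfibrationAt (π : A ⥤ X) {x y : X} (f : x ⟶ y) : Prop :=
  ∀ a : A, π.obj a = x → ∃! p : Σ b : A, (a ⟶ b), π.IsHomLift f p.2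

/-- `π : A ⥤ X` is a discrete opfibration. -/
def IsDiscreteOpfibration (π : A ⥤ X) : Prop :=
  ∀ ⦃x y : X⦄ (f : x ⟶ y), IsDiscreteOpfibrationAt π f

/-- The lifts of a functor `D` along `π`: functors `L` with `π ∘ L = D`, strictly. -/
def Lift {J : Type u₂} [Category.{v₂} J] (D : J ⥤ X) (π : A ⥤ X) :=
  { L : J ⥤ A // L ⋙ π = D }

/-- Two morphisms with the same domain and the same codomain over `f` agree. -/
theorem IsDiscreteOpfibration.hom_unique {π : A ⥤ X} (hπ : IsDiscreteOpfibration π)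
    {x y : X} (f : x ⟶ y) {a b : A} (φ ψ : a ⟶ b) (hφ : π.IsHomLift f φ) (hψ : π.IsHomLift f ψ) :
    φ = ψ := by
  have h := (hπ f a (IsHomLift.domain_eq π f φ)).unique (y₁ := ⟨b, φ⟩) (y₂ := ⟨b, ψ⟩) hφ hψ
  simpa using h

end DiscreteOpfibrations

/-! ### Transport of lifts along a 2-cell

For `R : K ⥤ J`, `D : J ⥤ X`, `E : K ⥤ X` and `ρ : D ∘ R ⟶ E`, a lift of `D` along a discrete
opfibration `π` is sent to the lift of `E` whose value at `k` is the codomain of the unique lift of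
`ρ k`. -/

section Transport

variable {X : Type u} [Category.{v} X] {A : Type u₁} [Category.{v₁} A]
  {J : Type u₂} [Category.{v₂} J] {K : Type u₃} [Category.{v₃} K]
  {D : J ⥤ X} {E : K ⥤ X} {π : A ⥤ X}

theorem exists_transport_obj (hπ : IsDiscreteOpfibration π) (R : K ⥤ J) (ρ : R ⋙ D ⟶ E)
    (L : Lift D π) (k : K) :
    ∃! p : Σ b : A, (L.1.obj (R.obj k) ⟶ b), π.IsHomLift (ρ.app k) p.2 :=
  hπ (ρ.app k) (L.1.obj (R.obj k)) (Functor.congr_obj L.2 (R.obj k))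

/-- The object part of the transported lift. -/
noncomputable def transportObj (hπ : IsDiscreteOpfibration π) (R : K ⥤ J) (ρ : R ⋙ D ⟶ E)
    (L : Lift D π) (k : K) : A :=
  (exists_transport_obj hπ R ρ L k).choose.1

/-- The unique lift of `ρ k` with domain `L (R k)`. -/
noncomputable def transportComponent (hπ : IsDiscreteOpfibration π) (R : K ⥤ J) (ρ : R ⋙ D ⟶ E)
    (L : Lift D π) (k : K) :
    L.1.obj (R.obj k) ⟶ transportObj hπ R ρ L k :=
  (exists_transport_obj hπ R ρ L k).choose.2

theorem transportComponent_isHomLift (hπ : IsDiscreteOpfibration π) (R : K ⥤ J) (ρ : R ⋙ D ⟶ E)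
    (L : Lift D π) (k : K) :
    π.IsHomLift (ρ.app k) (transportComponent hπ R ρ L k) :=
  (exists_transport_obj hπ R ρ L k).choose_spec.1

theorem exists_transport_map (hπ : IsDiscreteOpfibration π) (R : K ⥤ J) (ρ : R ⋙ D ⟶ E)
    (L : Lift D π) {k k' : K} (g : k ⟶ k') :
    ∃ φ : transportObj hπ R ρ L k ⟶ transportObj hπ R ρ L k', π.IsHomLift (E.map g) φ := by
  have h1 := transportComponent_isHomLift hπ R ρ L k
  have h2 := transportComponent_isHomLift hπ R ρ L k'
  obtain ⟨⟨b, φ⟩, hφ, -⟩ := hπ (E.map g) (transportObj hπ R ρ L k)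
    (IsHomLift.codomain_eq π (ρ.app k) (transportComponent hπ R ρ L k))
  have hL : π.IsHomLift ((R ⋙ D).map g) (L.1.map (R.map g)) := by
    obtain ⟨L, rfl⟩ := L
    exact IsHomLift.map π (L.map (R.map g))
  have e1 : π.IsHomLift (ρ.app k ≫ E.map g) (transportComponent hπ R ρ L k ≫ φ) :=
    inferInstance
  have e2 : π.IsHomLift (ρ.app k ≫ E.map g)
      (L.1.map (R.map g) ≫ transportComponent hπ R ρ L k') := by
    rw [← ρ.naturality g]
    infer_instance
  have h := (hπ (ρ.app k ≫ E.map g) (L.1.obj (R.obj k))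
    (Functor.congr_obj L.2 (R.obj k))).unique
      (y₁ := ⟨b, transportComponent hπ R ρ L k ≫ φ⟩)
      (y₂ := ⟨_, L.1.map (R.map g) ≫ transportComponent hπ R ρ L k'⟩) e1 e2
  obtain rfl : b = transportObj hπ R ρ L k' := congrArg Sigma.fst h
  exact ⟨φ, hφ⟩

/-- The morphism part of the transported lift: the unique lift of `E g`. -/
noncomputable def transportMap (hπ : IsDiscreteOpfibration π) (R : K ⥤ J) (ρ : R ⋙ D ⟶ E)
    (L : Lift D π) {k k' : K} (g : k ⟶ k') :
    transportObj hπ R ρ L k ⟶ transportObj hπ R ρ L k' :=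
  (exists_transport_map hπ R ρ L g).choose

theorem transportMap_isHomLift (hπ : IsDiscreteOpfibration π) (R : K ⥤ J) (ρ : R ⋙ D ⟶ E)
    (L : Lift D π) {k k' : K} (g : k ⟶ k') :
    π.IsHomLift (E.map g) (transportMap hπ R ρ L g) :=
  (exists_transport_map hπ R ρ L g).choose_spec

theorem obj_transportObj (hπ : IsDiscreteOpfibration π) (R : K ⥤ J) (ρ : R ⋙ D ⟶ E)
    (L : Lift D π) (k : K) : π.obj (transportObj hπ R ρ L k) = E.obj k :=
  have := transportComponent_isHomLift hπ R ρ L k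
  IsHomLift.codomain_eq π (ρ.app k) (transportComponent hπ R ρ L k)

/-- The functor `K ⥤ A` underlying the transported lift. -/
noncomputable def transportFunctor (hπ : IsDiscreteOpfibration π) (R : K ⥤ J) (ρ : R ⋙ D ⟶ E)
    (L : Lift D π) : K ⥤ A where
  obj := transportObj hπ R ρ L
  map g := transportMap hπ R ρ L g
  map_id k := by
    refine hπ.hom_unique (E.map (𝟙 k)) _ _ (transportMap_isHomLift hπ R ρ L (𝟙 k)) ?_
    rw [E.map_id]
    exact IsHomLift.id (obj_transportObj hπ R ρ L k)
  map_comp g g' := by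
    have := transportMap_isHomLift hπ R ρ L g
    have := transportMap_isHomLift hπ R ρ L g'
    refine hπ.hom_unique (E.map (g ≫ g')) _ _ (transportMap_isHomLift hπ R ρ L (g ≫ g')) ?_
    rw [E.map_comp]
    infer_instance

theorem transportFunctor_comp (hπ : IsDiscreteOpfibration π) (R : K ⥤ J) (ρ : R ⋙ D ⟶ E)
    (L : Lift D π) : transportFunctor hπ R ρ L ⋙ π = E := by
  refine CategoryTheory.Functor.ext (fun k => obj_transportObj hπ R ρ L k) (fun k k' g => ?_)
  have := transportMap_isHomLift hπ R ρ L g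
  exact IsHomLift.fac' π (E.map g) (transportMap hπ R ρ L g)

/-- The map from lifts of `D` to lifts of `E` induced by `(R, ρ)`. -/
noncomputable def transport (hπ : IsDiscreteOpfibration π) (R : K ⥤ J) (ρ : R ⋙ D ⟶ E)
    (L : Lift D π) : Lift E π :=
  ⟨transportFunctor hπ R ρ L, transportFunctor_comp hπ R ρ L⟩

end Transport

/-! ### The slice `Cat/X` and the contravariant diagram category `Diag←(X)`

Small means small relative to the universe `v` of the hom-sets of `X`. -/

section Categories

variable (X : Type u) [Category.{v} X]

/-- Objects of `Cat/X`: small categories with a functor to `X`. The category `X` itself may have a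
large set of objects, so this is not an `Over` category of `Cat`. -/
structure CatOver where
  /-- the indexing category -/
  shape : Cat.{v, v}
  /-- the diagram -/
  diagram : shape ⥤ X

/-- Objects of `Diag←(X)`: diagrams in `X` indexed by small categories. -/
structure DiagLeft where
  /-- the indexing category -/
  shape : Cat.{v, v}
  /-- the diagram -/
  diagram : shape ⥤ X

variable {X}

/-- Morphisms `(J, D) ⟶ (K, E)` of `Cat/X`: functors `R : J ⥤ K` with `E ∘ R = D`. -/
@[ext]
structure CatOver.Hom (P Q : CatOver.{v} X) where
  /-- the functor between the indexing categories -/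
  functor : P.shape ⥤ Q.shape
  w : functor ⋙ Q.diagram = P.diagram

instance : Category (CatOver.{v} X) where
  Hom P Q := CatOver.Hom P Q
  id P := ⟨𝟭 _, rfl⟩
  comp {P Q S} f g := ⟨f.functor ⋙ g.functor, by rw [Functor.assoc, g.w, f.w]⟩

/-- Morphisms `(J, D) ⟶ (K, E)` of `Diag←(X)`: pairs of a functor `R : K ⥤ J` and a natural
transformation `ρ : D ∘ R ⟶ E`. -/
@[ext]
structure DiagLeft.Hom (P Q : DiagLeft.{v} X) where
  /-- the functor between the indexing categories -/
  functor : Q.shape ⥤ P.shape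
  /-- the natural transformation -/
  trans : functor ⋙ P.diagram ⟶ Q.diagram

/-- The composite of `(R, ρ)` and `(S, σ)` is `(R ∘ S, σ ∘ ρS)`. -/
instance : Category (DiagLeft.{v} X) where
  Hom P Q := DiagLeft.Hom P Q
  id P := ⟨𝟭 _, (Functor.leftUnitor P.diagram).hom⟩
  comp {P Q S} f g := ⟨g.functor ⋙ f.functor,
    (Functor.associator g.functor f.functor P.diagram).hom ≫
      Functor.whiskerLeft g.functor f.trans ≫ g.trans⟩
  id_comp f := by
    refine DiagLeft.Hom.ext rfl (heq_of_eq ?_)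
    ext k
    simp
  comp_id f := by
    refine DiagLeft.Hom.ext rfl (heq_of_eq ?_)
    ext k
    simp
  assoc f g h := by
    refine DiagLeft.Hom.ext rfl (heq_of_eq ?_)
    ext k
    simp

@[simp] theorem CatOver.id_functor (P : CatOver.{v} X) :
    CatOver.Hom.functor (𝟙 P) = 𝟭 _ := rfl

@[simp] theorem CatOver.comp_functor {P Q S : CatOver.{v} X} (f : P ⟶ Q) (g : Q ⟶ S) :
    CatOver.Hom.functor (f ≫ g) = f.functor ⋙ g.functor := rfl

@[simp] theorem DiagLeft.id_functor (P : DiagLeft.{v} X) :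
    DiagLeft.Hom.functor (𝟙 P) = 𝟭 _ := rfl

@[simp] theorem DiagLeft.comp_functor {P Q S : DiagLeft.{v} X} (f : P ⟶ Q) (g : Q ⟶ S) :
    DiagLeft.Hom.functor (f ≫ g) = g.functor ⋙ f.functor := rfl

@[simp] theorem DiagLeft.id_trans_app (P : DiagLeft.{v} X) (k : P.shape) :
    (DiagLeft.Hom.trans (𝟙 P)).app k = 𝟙 (P.diagram.obj k) := rfl

@[simp] theorem DiagLeft.comp_trans_app {P Q S : DiagLeft.{v} X} (f : P ⟶ Q) (g : Q ⟶ S)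
    (k : S.shape) :
    (DiagLeft.Hom.trans (f ≫ g)).app k = f.trans.app (g.functor.obj k) ≫ g.trans.app k := by
  change 𝟙 _ ≫ _ = _
  exact Category.id_comp _

variable (X)

/-- The inclusion `(Cat/X)ᵒᵖ ⥤ Diag←(X)`: the identity on objects, and a functor over `X` is
regarded as a morphism of diagrams whose natural transformation is an identity. -/
def inclusion : (CatOver.{v} X)ᵒᵖ ⥤ DiagLeft.{v} X where
  obj P := ⟨P.unop.shape, P.unop.diagram⟩
  map f := ⟨f.unop.functor, eqToHom f.unop.w⟩
  map_id P := by
    refine DiagLeft.Hom.ext rfl (heq_of_eq ?_)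
    ext k
    rfl
  map_comp {P Q S} f g := by
    refine DiagLeft.Hom.ext rfl (heq_of_eq ?_)
    ext k
    simp [eqToHom_app]

/-- The class of morphisms of `Cat/X` whose underlying functor is initial. -/
def initialMorphisms : MorphismProperty (CatOver.{v} X) :=
  fun _ _ f => f.functor.Initial

/-- The class of weak equivalences of `Diag←(X)`: the morphisms `(R, ρ) : (J, D) ⟶ (K, E)` that
induce a bijection from the lifts of `D` to the lifts of `E` along every discrete opfibration
over `X`. -/
def weakEquivalences : MorphismProperty (DiagLeft.{v} X) :=
  fun P Q f => ∀ (A : Type (max u v)) [Category.{v} A] (π : A ⥤ X)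
    (hπ : IsDiscreteOpfibration π),
    Function.Bijective
      (transport hπ f.functor f.trans : Lift P.diagram π → Lift Q.diagram π)

/-- The objects of `Cat/X` that are discrete opfibrations over `X`. -/
def discreteOpfibrations : ObjectProperty (CatOver.{v} X) :=
  fun P => IsDiscreteOpfibration P.diagram

end Categories

end DiagLoc

/-!
The proof compares both localizations with the universal property of the category of diagrams: it
extends functors from `(Cat/X)ᵒᵖ` to `Diag←(X)` by means of collages.

Initial functors are left orthogonal to discrete opfibrations
(`IsDiscreteOpfibration.existsUnique_extension`), so the inclusion sends them to weak equivalences.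
This gives the comparison functor.

For its inverse, let `(R, ρ) : (J, D) ⟶ (K, E)` be a morphism of diagrams. The collage of `R` is the
category on `J ⊔ K` whose morphisms `j ⟶ k` are the morphisms `j ⟶ R k` of `J`; using `ρ` it becomes
an object of `Cat/X`. The inclusion of `J` is initial, being a left adjoint. A functor `G` on
`(Cat/X)ᵒᵖ` that inverts initial functors is therefore extended to diagrams by sending `(R, ρ)` to
the composite of the inverse of `G` at the inclusion of `J` with `G` at the inclusion of `K`
(`extend`). The universal property of the collage shows that every cocone under `(R, ρ)` computes
this composite (`map_comp_extendMap`), whence functoriality. The extension is unique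
(`functor_ext_of_inclusion_comp`), because in `Diag←(X)` the inclusion of `J` followed by `(R, ρ)`
is related by a 2-cell to the inclusion of `K`, and 2-cells become equalities as soon as the
projections of cylinders, which are collages of identities, are inverted (`map_eq_of_two_cell`).

The extension inverts weak equivalences (`isInvertedBy_extend`). Since `(R, ρ)` and its collage act
compatibly on lifts, it suffices to consider a morphism `f : P ⟶ Q` of `Cat/X`. Factor `P` and `Q`
as an initial functor followed by a discrete opfibration, namely the category of elements of
`x ↦ π₀ (P / x)`. If `f` is a weak equivalence, then it induces an isomorphism between the two
categories of elements, so both `P` and `Q` map initially to one of them. That category is as large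
as `X`, but its full subcategory on the image of `Q` is small, and the maps to it are still initial
(`exists_initial_of_weakEquivalences`). Thus `f` is inverted by 2-out-of-3.

When `X` is small, the category of elements itself may be replaced by a small isomorphic one. Hence
the discrete opfibrations form a reflective subcategory of `Cat/X`, whose objects are local for the
initial functors and whose units are initial; so it is a model for the localization at these.
-/

namespace DiagLoc

/-! ### Lifts along discrete opfibrations -/

section Lifts

variable {X : Type u} [Category.{v} X] {A : Type u₁} [Category.{v₁} A]
  {J : Type u₂} [Category.{v₂} J] {K : Type u₃} [Category.{v₃} K] {π : A ⥤ X}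

theorem isHomLift_map_of_comp_eq {D : J ⥤ X} {L : J ⥤ A} (h : L ⋙ π = D) {j j' : J} (g : j ⟶ j') :
    π.IsHomLift (D.map g) (L.map g) := by
  subst h
  exact IsHomLift.map π (L.map g)

theorem isHomLift_eqToHom_app {D D' : J ⥤ X} (h : D = D') (j : J) {a : A}
    (ha : π.obj a = D.obj j) : π.IsHomLift ((eqToHom h).app j) (𝟙 a) := by
  subst h
  exact IsHomLift.id ha

theorem IsDiscreteOpfibration.codomain_unique (hπ : IsDiscreteOpfibration π) {x y : X} (f : x ⟶ y)
    {a b b' : A} (φ : a ⟶ b) (φ' : a ⟶ b') (h : π.IsHomLift f φ) (h' : π.IsHomLift f φ') :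
    b = b' :=
  congrArg Sigma.fst ((hπ f a (IsHomLift.domain_eq π f φ)).unique (y₁ := ⟨b, φ⟩) (y₂ := ⟨b', φ'⟩)
    h h')

/-- A lift along a discrete opfibration is determined by its values on objects. -/
theorem IsDiscreteOpfibration.lift_ext (hπ : IsDiscreteOpfibration π) {D : J ⥤ X} {L L' : J ⥤ A}
    (h : L ⋙ π = D) (h' : L' ⋙ π = D) (hobj : ∀ j, L.obj j = L'.obj j) : L = L' := by
  refine CategoryTheory.Functor.ext hobj fun j j' g => ?_
  have := isHomLift_map_of_comp_eq h' g
  exact hπ.hom_unique (D.map g) _ _ (isHomLift_map_of_comp_eq h g) inferInstance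

/-- A family of objects of the total category underlies a lift as soon as all morphisms of the
diagram lift to it: the lifted morphisms are unique, hence functorial. -/
theorem IsDiscreteOpfibration.exists_lift (hπ : IsDiscreteOpfibration π) (E : K ⥤ X)
    (F : K → A) (hF : ∀ k, π.obj (F k) = E.obj k)
    (hmap : ∀ {k k' : K} (g : k ⟶ k'), ∃ φ : F k ⟶ F k', π.IsHomLift (E.map g) φ) :
    ∃ L : K ⥤ A, L ⋙ π = E ∧ ∀ k, L.obj k = F k := by
  choose φ hφ using @hmap
  refine ⟨{ obj := F, map := φ, map_id := fun k => ?_, map_comp := fun g g' => ?_ }, ?_,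
    fun _ => rfl⟩
  · refine hπ.hom_unique (E.map (𝟙 k)) _ _ (hφ _) ?_
    rw [E.map_id]
    exact IsHomLift.id (hF k)
  · have := hφ g
    have := hφ g'
    refine hπ.hom_unique (E.map (g ≫ g')) _ _ (hφ _) ?_
    rw [E.map_comp]
    infer_instance
  · refine CategoryTheory.Functor.ext hF fun k k' g => ?_
    have := hφ g
    exact IsHomLift.fac' π (E.map g) (φ g)

/-- Initial functors are left orthogonal to discrete opfibrations. The value of the diagonal filler
at `k` is the codomain of the lift of `E u` for any `u : R j ⟶ k`; it does not depend on `u` since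
the comma category `R / k` is connected. -/
theorem IsDiscreteOpfibration.existsUnique_extension (hπ : IsDiscreteOpfibration π) (R : J ⥤ K)
    [R.Initial] (E : K ⥤ X) (L : J ⥤ A) (hL : L ⋙ π = R ⋙ E) :
    ∃! M : K ⥤ A, M ⋙ π = E ∧ R ⋙ M = L := by
  have hobj : ∀ j, π.obj (L.obj j) = E.obj (R.obj j) := fun j => Functor.congr_obj hL j
  have lift : ∀ (k : K) (u : CostructuredArrow R k),
      ∃ p : Σ b : A, (L.obj u.left ⟶ b), π.IsHomLift (E.map u.hom) p.2 := fun k u =>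
    (hπ (E.map u.hom) (L.obj u.left) (hobj _)).exists
  choose p hp using lift
  have const : ∀ (k : K) (u u' : CostructuredArrow R k), (p k u).1 = (p k u').1 := by
    intro k
    have : IsConnected (CostructuredArrow R k) := Functor.Initial.out k
    refine constant_of_preserves_morphisms (fun u => (p k u).1) fun u u' m => ?_
    have h1 : π.IsHomLift (E.map (R.map m.left)) (L.map m.left) := isHomLift_map_of_comp_eq hL m.left
    have h2 := hp k u'
    refine hπ.codomain_unique (E.map u.hom) (p k u).2 (L.map m.left ≫ (p k u').2) (hp k u) ?_
    rw [← CostructuredArrow.w m, E.map_comp]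
    exact IsHomLift.comp π (E.map (R.map m.left)) (E.map u'.hom) _ _
  have arrow : ∀ k : K, Nonempty (CostructuredArrow R k) := fun k =>
    (Functor.Initial.out (F := R) k).is_nonempty
  let c : ∀ k : K, CostructuredArrow R k := fun k => (arrow k).some
  obtain ⟨M, hM, hMobj⟩ := hπ.exists_lift E (fun k => (p k (c k)).1)
    (fun k => have := hp k (c k); IsHomLift.codomain_eq π (E.map (c k).hom) (p k (c k)).2)
    (fun {k k'} g => by
      have h1 := hp k (c k)
      obtain ⟨⟨b, φ⟩, hφ⟩ := (hπ (E.map g) (p k (c k)).1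
        (IsHomLift.codomain_eq π (E.map (c k).hom) (p k (c k)).2)).exists
      let u : CostructuredArrow R k' := CostructuredArrow.mk ((c k).hom ≫ g)
      have h2 : π.IsHomLift (E.map u.hom) ((p k (c k)).2 ≫ φ) := by
        have : π.IsHomLift (E.map g) φ := hφ
        rw [show u.hom = (c k).hom ≫ g from rfl, E.map_comp]
        infer_instance
      obtain rfl : b = (p k' (c k')).1 :=
        (hπ.codomain_unique (E.map u.hom) _ (p k' u).2 h2 (hp k' u)).trans (const k' u (c k'))
      exact ⟨φ, hφ⟩)
  refine ⟨M, ⟨hM, ?_⟩, ?_⟩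
  · refine hπ.lift_ext (D := R ⋙ E) (by rw [Functor.assoc, hM]) hL fun j => ?_
    let u : CostructuredArrow R (R.obj j) := CostructuredArrow.mk (𝟙 (R.obj j))
    refine (hMobj _).trans ((const _ _ u).trans ?_)
    refine hπ.codomain_unique (E.map u.hom) (p _ u).2 (𝟙 (L.obj j)) (hp _ u) ?_
    rw [show u.hom = 𝟙 _ from rfl, E.map_id]
    exact IsHomLift.id (hobj j)
  · rintro N ⟨hN, rfl⟩
    refine hπ.lift_ext hN hM fun k => ?_
    refine Eq.trans ?_ (hMobj k).symm
    exact hπ.codomain_unique (E.map (c k).hom) (N.map (c k).hom) (p k (c k)).2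
      (isHomLift_map_of_comp_eq hN _) (hp k (c k))

/-- The transported lift is the only lift of `E` that receives a natural transformation over `ρ`. -/
theorem transport_eq (hπ : IsDiscreteOpfibration π) {D : J ⥤ X} {E : K ⥤ X} (R : K ⥤ J)
    (ρ : R ⋙ D ⟶ E) (L : Lift D π) (M : Lift E π) (τ : R ⋙ L.1 ⟶ M.1)
    (hτ : ∀ k, π.IsHomLift (ρ.app k) (τ.app k)) : transport hπ R ρ L = M :=
  Subtype.ext (hπ.lift_ext (transport hπ R ρ L).2 M.2 fun k =>
    hπ.codomain_unique (ρ.app k) (transportComponent hπ R ρ L k) (τ.app k)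
      (transportComponent_isHomLift hπ R ρ L k) (hτ k))

end Lifts

/-! ### The comprehensive factorisation -/

section Factorisation

variable {X : Type u} [Category.{v} X]

theorem isDiscreteOpfibration_elements (F : X ⥤ Type v₁) :
    IsDiscreteOpfibration (CategoryOfElements.π F) := by
  rintro _ y f a rfl
  refine ⟨⟨⟨y, F.map f a.2⟩, CategoryOfElements.homMk a ⟨y, F.map f a.2⟩ f rfl⟩,
    IsHomLift.map (CategoryOfElements.π F)
      (CategoryOfElements.homMk a ⟨y, F.map f a.2⟩ f rfl), ?_⟩
  rintro ⟨⟨b, t⟩, φ, h⟩ (hφ : (CategoryOfElements.π F).IsHomLift f _)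
  obtain rfl : b = y := @IsHomLift.codomain_eq _ _ _ _ (CategoryOfElements.π F) _ _ _ _ f _ hφ
  obtain rfl : f = φ := @IsHomLift.eq_of_isHomLift _ _ _ _ (CategoryOfElements.π F)
    a ⟨b, t⟩ f (CategoryOfElements.homMk a ⟨b, t⟩ φ h) hφ
  obtain rfl : F.map f a.2 = t := h
  rfl

/-- The copresheaf `x ↦ π₀ (E / x)`, which is the left Kan extension of the terminal copresheaf
along `E`. -/
def componentsCopresheaf {K : Type u₁} [Category.{v₁} K] (E : K ⥤ X) : X ⥤ Type (max u₁ v) where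
  obj x := ConnectedComponents (CostructuredArrow E x)
  map f := ↾(CostructuredArrow.map f).mapConnectedComponents
  map_id x := by
    ext ⟨c⟩
    exact congrArg Quotient.mk'' CostructuredArrow.map_id
  map_comp f g := by
    ext ⟨c⟩
    exact congrArg Quotient.mk'' CostructuredArrow.map_comp

variable {K : Type u₁} [Category.{v₁} K] (E : K ⥤ X)

/-- The component of `E / x` that contains `f : E k ⟶ x`. -/
def arrowComponent {k : K} {x : X} (f : E.obj k ⟶ x) : (componentsCopresheaf E).obj x :=
  CategoryTheory.ConnectedComponents.mk (CostructuredArrow.mk f)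

theorem componentsCopresheaf_map_arrowComponent {k : K} {x y : X} (f : E.obj k ⟶ x) (g : x ⟶ y) :
    (componentsCopresheaf E).map g (arrowComponent E f) = arrowComponent E (f ≫ g) :=
  rfl

theorem arrowComponent_map {k k' : K} (g : k ⟶ k') {x : X} (f : E.obj k' ⟶ x) :
    arrowComponent E (E.map g ≫ f) = arrowComponent E f :=
  Quotient.sound' (Zigzag.of_hom (CostructuredArrow.homMk g rfl))

theorem componentsCopresheaf_map_arrowComponent_id {k : K} {x : X} (f : E.obj k ⟶ x) :
    (componentsCopresheaf E).map f (arrowComponent E (𝟙 (E.obj k))) = arrowComponent E f := by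
  rw [componentsCopresheaf_map_arrowComponent, Category.id_comp]

/-- The first factor of the comprehensive factorisation, sending `k` to the component of the
identity of `E k`. -/
def toElements : K ⥤ (componentsCopresheaf E).Elements where
  obj k := ⟨E.obj k, arrowComponent E (𝟙 (E.obj k))⟩
  map f := ⟨E.map f, (componentsCopresheaf_map_arrowComponent_id E _).trans
    ((congrArg _ (Category.comp_id _).symm).trans (arrowComponent_map E f (𝟙 _)))⟩
  map_id k := Subtype.ext (E.map_id k)
  map_comp f g := Subtype.ext (E.map_comp f g)

/-- A component `c` of `E / x`, as an element of the copresheaf of components. -/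
def componentElement (x : X) (c : CategoryTheory.ConnectedComponents (CostructuredArrow E x)) :
    (componentsCopresheaf E).Elements :=
  ⟨x, c⟩

/-- The comparison of the component `c` of `E / x` with the comma category of `toElements E` over
the element `c`. -/
def componentToCostructuredArrow (x : X)
    (c : CategoryTheory.ConnectedComponents (CostructuredArrow E x)) :
    c.Component ⥤ CostructuredArrow (toElements E) (componentElement E x c) where
  obj u := CostructuredArrow.mk (Y := u.obj.left)
    ⟨u.obj.hom, (componentsCopresheaf_map_arrowComponent_id E _).trans u.property⟩
  map m := CostructuredArrow.homMk m.hom.left (Subtype.ext (CostructuredArrow.w m.hom))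

/-- The comma category of `toElements E` over an element `c` is connected because all its objects
come from the connected component `c`. -/
instance initial_toElements : (toElements E).Initial where
  out := by
    rintro ⟨x, (c : CategoryTheory.ConnectedComponents (CostructuredArrow E x))⟩
    change IsConnected (CostructuredArrow (toElements E) (componentElement E x c))
    have surj : ∀ v, ∃ u, (componentToCostructuredArrow E x c).obj u = v := fun v =>
      ⟨⟨CostructuredArrow.mk (Y := v.left) v.hom.1,
        (componentsCopresheaf_map_arrowComponent_id E _).symm.trans v.hom.2⟩, rfl⟩
    have : Nonempty (CostructuredArrow (toElements E) (componentElement E x c)) :=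
      ⟨(componentToCostructuredArrow E x c).obj (Classical.arbitrary c.Component)⟩
    refine zigzag_isConnected fun v v' => ?_
    obtain ⟨u, rfl⟩ := surj v
    obtain ⟨u', rfl⟩ := surj v'
    exact zigzag_obj_of_zigzag _ (isPreconnected_zigzag u u')

end Factorisation

section Shrinking

variable {X : Type u} [Category.{v} X] {A : Type u₁} [Category.{v₁} A]

theorem isDiscreteOpfibration_comp_of_isIso {B : Type u₂} [Category.{v₂} B] {π : A ⥤ X}
    (hπ : IsDiscreteOpfibration π) (G : B ⥤ A) [G.IsIso] : IsDiscreteOpfibration (G ⋙ π) := by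
  intro x y f b hb
  obtain ⟨⟨a, φ⟩, hφ, -⟩ := hπ f (G.obj b) hb
  obtain ⟨b', rfl⟩ := (Functor.bijective_obj G).2 a
  obtain ⟨φ, rfl⟩ := G.map_surjective φ
  have of_map : ∀ {c : B} (ψ : b ⟶ c), (G ⋙ π).IsHomLift f ψ → π.IsHomLift f (G.map ψ) := by
    rintro c ψ ⟨⟩
    exact IsHomLift.map π (G.map ψ)
  refine ⟨⟨b', φ⟩, ?_, ?_⟩
  · obtain ⟨⟩ := hφ
    exact IsHomLift.map (G ⋙ π) φ
  · rintro ⟨c, ψ⟩ hψ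
    obtain rfl : c = b' := (Functor.bijective_obj G).1
      (hπ.codomain_unique f (G.map ψ) (G.map φ) (of_map ψ hψ) hφ)
    obtain rfl : ψ = φ := G.map_injective (hπ.hom_unique f _ _ (of_map ψ hψ) hφ)
    rfl

end Shrinking

/-! ### The collage of a functor -/

/-- The collage of `R : K ⥤ J`: the disjoint union of `J` and `K` together with morphisms
`j ⟶ k` given by the morphisms `j ⟶ R k` of `J`. -/
inductive Collage {J : Type u₁} [Category.{v₁} J] {K : Type u₂} [Category.{v₁} K] (R : K ⥤ J) :
    Type (max u₁ u₂)
  | left (j : J) : Collage R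
  | right (k : K) : Collage R

namespace Collage

variable {J : Type u₁} [Category.{v₁} J] {K : Type u₂} [Category.{v₁} K] {R : K ⥤ J}

/-- Morphisms of the collage. -/
def Hom : Collage R → Collage R → Type v₁
  | left j, left j' => j ⟶ j'
  | left j, right k => j ⟶ R.obj k
  | right _, left _ => PEmpty
  | right k, right k' => k ⟶ k'

/-- Identities of the collage. -/
def id : ∀ c : Collage R, Hom c c
  | left j => 𝟙 j
  | right k => 𝟙 k

/-- Composition in the collage; morphisms of `K` act on morphisms `j ⟶ R k` through `R`. -/
def comp : ∀ {a b c : Collage R}, Hom a b → Hom b c → Hom a c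
  | left _, left _, left _, f, g => CategoryStruct.comp (obj := J) f g
  | left _, left _, right _, f, g => CategoryStruct.comp (obj := J) f g
  | left _, right _, right _, f, g => CategoryStruct.comp (obj := J) f (R.map g)
  | right _, right _, right _, f, g => CategoryStruct.comp (obj := K) f g

instance : Category (Collage R) where
  Hom := Hom
  id := id
  comp := comp
  id_comp {a b} f := by
    cases a <;> cases b <;>
      first
      | exact f.elim
      | exact Category.id_comp (obj := J) f
      | exact Category.id_comp (obj := K) f
  comp_id {a b} f := by
    cases a <;> cases b <;>
      first
      | exact f.elim
      | exact Category.comp_id (obj := J) f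
      | exact Category.comp_id (obj := K) f
      | exact (congrArg (CategoryStruct.comp (obj := J) f) (R.map_id _)).trans
          (Category.comp_id (obj := J) f)
  assoc {a b c d} f g h := by
    cases a <;> cases b <;> cases c <;> cases d <;>
      first
      | exact f.elim
      | exact g.elim
      | exact h.elim
      | exact Category.assoc (obj := J) f g h
      | exact Category.assoc (obj := K) f g h
      | exact Category.assoc (obj := J) f g (R.map h)
      | exact (Category.assoc (obj := J) f (R.map g) (R.map h)).trans
          (congrArg (CategoryStruct.comp (obj := J) f) (R.map_comp g h).symm)

variable (R)

/-- The inclusion of `J` into the collage of `R : K ⥤ J`. -/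
def inl : J ⥤ Collage R where
  obj := left
  map f := f

/-- The inclusion of `K` into the collage of `R : K ⥤ J`. -/
def inr : K ⥤ Collage R where
  obj := right
  map f := f

/-- The universal 2-cell of the collage. -/
def cell : R ⋙ inl R ⟶ inr R where
  app k := (𝟙 (R.obj k) : R.obj k ⟶ R.obj k)
  naturality _ _ g := (Category.comp_id (R.map g)).trans (Category.id_comp (R.map g)).symm

variable {R} {C : Type u₃} [Category.{v₃} C]

/-- The universal property of the collage: a functor out of it is a pair of functors on `J` and
on `K` with a natural transformation between their restrictions to `K`. -/
def desc (F : J ⥤ C) (G : K ⥤ C) (θ : R ⋙ F ⟶ G) : Collage R ⥤ C where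
  obj
    | left j => F.obj j
    | right k => G.obj k
  map {a b} := match a, b with
    | left _, left _ => fun f => F.map f
    | left _, right k => fun f => F.map f ≫ θ.app k
    | right _, left _ => fun f => f.elim
    | right _, right _ => fun f => G.map f
  map_id
    | left j => F.map_id j
    | right k => G.map_id k
  map_comp {a b c} f g := by
    cases a <;> cases b <;> cases c <;>
      first
      | exact PEmpty.elim f
      | exact PEmpty.elim g
      | exact F.map_comp f g
      | exact G.map_comp f g
      | exact (congrArg (· ≫ θ.app _) (F.map_comp f g)).trans (Category.assoc _ _ _)
      | exact (congrArg (· ≫ θ.app _) (F.map_comp f (R.map g))).trans ((Category.assoc _ _ _).trans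
          ((congrArg (F.map f ≫ ·) (θ.naturality g)).trans (Category.assoc _ _ _).symm))

theorem desc_map_cell (F : J ⥤ C) (G : K ⥤ C) (θ : R ⋙ F ⟶ G) (k : K) :
    (desc F G θ).map ((cell R).app k) = θ.app k :=
  (congrArg (· ≫ θ.app k) (F.map_id _)).trans (Category.id_comp _)

theorem desc_comp {C' : Type u} [Category.{v} C'] (T : C ⥤ C') (F : J ⥤ C) (G : K ⥤ C)
    (θ : R ⋙ F ⟶ G) {D : J ⥤ C'} {E : K ⥤ C'} (ρ : R ⋙ D ⟶ E) (hF : F ⋙ T = D) (hG : G ⋙ T = E)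
    (hθ : ∀ k, T.IsHomLift (ρ.app k) (θ.app k)) : desc F G θ ⋙ T = desc D E ρ := by
  subst hF hG
  obtain rfl : ρ = (Functor.associator _ _ _).inv ≫ Functor.whiskerRight θ T := by
    ext k
    have := hθ k
    exact (IsHomLift.eq_of_isHomLift T (a := F.obj (R.obj k)) (b := G.obj k) (ρ.app k)
      (θ.app k)).trans (Category.id_comp _).symm
  refine CategoryTheory.Functor.ext (fun c => by cases c <;> rfl) fun a b f => ?_
  cases a <;> cases b
  · exact ((Category.id_comp _).trans (Category.comp_id _)).symm
  · refine Eq.trans ?_ ((Category.id_comp _).trans (Category.comp_id _)).symm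
    simp [desc]
    rfl
  · exact f.elim
  · exact ((Category.id_comp _).trans (Category.comp_id _)).symm

variable (R)

/-- The left inclusion has the retraction that is `R` on `K` as a right adjoint. -/
def inlAdjunction : inl R ⊣ desc (𝟭 J) R (Functor.rightUnitor R).hom :=
  Adjunction.mkOfHomEquiv
    { homEquiv := fun j c => match c with
        | left j' => Equiv.refl (j ⟶ j')
        | right k => Equiv.refl (j ⟶ R.obj k)
      homEquiv_naturality_left_symm := fun {_ _ c} f g => by cases c <;> rfl
      homEquiv_naturality_right := fun {_ b c} f g => by
        cases b <;> cases c <;>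
          first
          | exact PEmpty.elim g
          | rfl
          | exact congrArg (CategoryStruct.comp (obj := J) f)
              (Category.comp_id (obj := J) g).symm }

instance initial_inl : (inl R).Initial :=
  Functor.initial_of_adjunction (inlAdjunction R)

end Collage

/-! ### Collages of morphisms of diagrams -/

section

variable {X : Type u} [Category.{v} X]

/-- A diagram, regarded as an object of `Cat/X`. -/
def DiagLeft.toCatOver (P : DiagLeft.{v} X) : CatOver.{v} X :=
  ⟨P.shape, P.diagram⟩

/-- The collage of the functor underlying a morphism `(R, ρ)` of diagrams, with the diagram that
sends the universal 2-cell to `ρ`. -/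
def DiagLeft.collage {P Q : DiagLeft.{v} X} (r : P ⟶ Q) : CatOver.{v} X :=
  ⟨Cat.of (Collage r.functor), Collage.desc P.diagram Q.diagram r.trans⟩

/-- The inclusion of the domain of a morphism of diagrams into its collage. -/
def DiagLeft.collageInl {P Q : DiagLeft.{v} X} (r : P ⟶ Q) : P.toCatOver ⟶ DiagLeft.collage r :=
  CatOver.Hom.mk (Collage.inl r.functor) rfl

/-- The inclusion of the codomain of a morphism of diagrams into its collage. -/
def DiagLeft.collageInr {P Q : DiagLeft.{v} X} (r : P ⟶ Q) : Q.toCatOver ⟶ DiagLeft.collage r :=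
  CatOver.Hom.mk (Collage.inr r.functor) rfl

theorem DiagLeft.initialMorphisms_collageInl {P Q : DiagLeft.{v} X} (r : P ⟶ Q) :
    initialMorphisms X (DiagLeft.collageInl r) :=
  Collage.initial_inl r.functor

theorem DiagLeft.exists_collage_desc {P Q : DiagLeft.{v} X} (r : P ⟶ Q) {T : CatOver.{v} X}
    (α : P.toCatOver ⟶ T) (β : Q.toCatOver ⟶ T) (θ : r.functor ⋙ α.functor ⟶ β.functor)
    (hθ : ∀ k, T.diagram.IsHomLift (r.trans.app k) (θ.app k)) :
    ∃ d : DiagLeft.collage r ⟶ T,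
      DiagLeft.collageInl r ≫ d = α ∧ DiagLeft.collageInr r ≫ d = β :=
  ⟨CatOver.Hom.mk (Collage.desc α.functor β.functor θ)
    (Collage.desc_comp T.diagram _ _ θ r.trans α.w β.w hθ),
    CatOver.Hom.ext rfl, CatOver.Hom.ext rfl⟩

theorem DiagLeft.collage_diagram_map_cell {P Q : DiagLeft.{v} X} (r : P ⟶ Q) (k : Q.shape) :
    (DiagLeft.collage r).diagram.map ((Collage.cell r.functor).app k) = r.trans.app k :=
  Collage.desc_map_cell P.diagram Q.diagram r.trans k

/-- The universal 2-cell of the collage lies over the natural transformation, also after applying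
a morphism of `Cat/X`. -/
theorem DiagLeft.isHomLift_map_cell {P Q : DiagLeft.{v} X} (r : P ⟶ Q) {T : CatOver.{v} X}
    (c : DiagLeft.collage r ⟶ T) (k : Q.shape) :
    T.diagram.IsHomLift (r.trans.app k) (c.functor.map ((Collage.cell r.functor).app k)) := by
  have h := isHomLift_map_of_comp_eq c.w ((Collage.cell r.functor).app k)
  have e := DiagLeft.collage_diagram_map_cell r k
  rwa [e] at h

/-! ### Extending functors from the slice to diagrams -/

section Extend

variable {M : Type u₁} [Category.{v₁} M]

/-- The value at `r` of the extension to diagrams of a functor `G` that inverts initial functors: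
`G` turns the cospan of the inclusions into the collage of `r` into a morphism, as it inverts the
first one. -/
noncomputable def extendMap (G : (CatOver.{v} X)ᵒᵖ ⥤ M)
    (hG : (initialMorphisms X).op.IsInvertedBy G) {P Q : DiagLeft.{v} X} (r : P ⟶ Q) :
    G.obj (op P.toCatOver) ⟶ G.obj (op Q.toCatOver) :=
  have := hG (DiagLeft.collageInl r).op (DiagLeft.initialMorphisms_collageInl r)
  inv (G.map (DiagLeft.collageInl r).op) ≫ G.map (DiagLeft.collageInr r).op

/-- Any cocone under a morphism of diagrams, not only the collage, computes the extension. -/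
theorem map_comp_extendMap (G : (CatOver.{v} X)ᵒᵖ ⥤ M)
    (hG : (initialMorphisms X).op.IsInvertedBy G) {P Q : DiagLeft.{v} X} (r : P ⟶ Q)
    {T : CatOver.{v} X} (α : P.toCatOver ⟶ T) (β : Q.toCatOver ⟶ T)
    (θ : r.functor ⋙ α.functor ⟶ β.functor)
    (hθ : ∀ k, T.diagram.IsHomLift (r.trans.app k) (θ.app k)) :
    G.map α.op ≫ extendMap G hG r = G.map β.op := by
  obtain ⟨d, rfl, rfl⟩ := DiagLeft.exists_collage_desc r α β θ hθ
  have := hG (DiagLeft.collageInl r).op (DiagLeft.initialMorphisms_collageInl r)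
  simp [extendMap]

theorem collageInl_comp_extendMap (G : (CatOver.{v} X)ᵒᵖ ⥤ M)
    (hG : (initialMorphisms X).op.IsInvertedBy G) {P Q : DiagLeft.{v} X} (r : P ⟶ Q) :
    G.map (DiagLeft.collageInl r).op ≫ extendMap G hG r = G.map (DiagLeft.collageInr r).op := by
  have := hG (DiagLeft.collageInl r).op (DiagLeft.initialMorphisms_collageInl r)
  simp [extendMap]

/-- The collage of `S.shape ⥤ Q.shape ⥤ collage r` receives `P`, `Q` and `S`, hence computes the
extensions of `r`, of `s` and of `r ≫ s` at the same time. -/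
theorem extendMap_comp (G : (CatOver.{v} X)ᵒᵖ ⥤ M)
    (hG : (initialMorphisms X).op.IsInvertedBy G) {P Q S : DiagLeft.{v} X} (r : P ⟶ Q)
    (s : Q ⟶ S) : extendMap G hG (r ≫ s) = extendMap G hG r ≫ extendMap G hG s := by
  let C : DiagLeft.{v} X := ⟨(DiagLeft.collage r).shape, (DiagLeft.collage r).diagram⟩
  let t : C ⟶ S := DiagLeft.Hom.mk (s.functor ⋙ Collage.inr r.functor) s.trans
  let c : DiagLeft.collage r ⟶ DiagLeft.collage t := DiagLeft.collageInl t
  have e1 := map_comp_extendMap G hG r (DiagLeft.collageInl r ≫ c) (DiagLeft.collageInr r ≫ c)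
    (Functor.whiskerRight (Collage.cell r.functor) c.functor) (DiagLeft.isHomLift_map_cell r c)
  have e2 := map_comp_extendMap G hG s (DiagLeft.collageInr r ≫ c) (DiagLeft.collageInr t)
    (Collage.cell t.functor) (DiagLeft.isHomLift_map_cell t (𝟙 _))
  have e3 := map_comp_extendMap G hG (r ≫ s) (DiagLeft.collageInl r ≫ c) (DiagLeft.collageInr t)
    (Functor.whiskerLeft s.functor (Functor.whiskerRight (Collage.cell r.functor) c.functor) ≫
      Collage.cell t.functor) (fun k => by
      have h1 := DiagLeft.isHomLift_map_cell r c (s.functor.obj k)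
      have h2 := DiagLeft.isHomLift_map_cell t (𝟙 _) k
      rw [DiagLeft.comp_trans_app]
      exact @IsHomLift.comp _ _ _ _ (DiagLeft.collage t).diagram _ _ _ _ _ _ _ _ _ _ h1 h2)
  have := hG (DiagLeft.collageInl r).op (DiagLeft.initialMorphisms_collageInl r)
  have : IsIso (G.map c.op) := hG c.op (DiagLeft.initialMorphisms_collageInl t)
  have : IsIso (G.map (DiagLeft.collageInl r ≫ c).op) := by
    rw [op_comp, G.map_comp]
    infer_instance
  rw [← cancel_epi (G.map (DiagLeft.collageInl r ≫ c).op), e3, ← Category.assoc, e1, e2]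

/-- The extension to diagrams of a functor on `(Cat/X)ᵒᵖ` that inverts initial functors. -/
noncomputable def extend (G : (CatOver.{v} X)ᵒᵖ ⥤ M)
    (hG : (initialMorphisms X).op.IsInvertedBy G) : DiagLeft.{v} X ⥤ M where
  obj P := G.obj (op P.toCatOver)
  map r := extendMap G hG r
  map_id P := by
    have e := map_comp_extendMap G hG (𝟙 P) (𝟙 _) (𝟙 _) (𝟙 (𝟭 P.shape)) (fun k => by
      exact IsHomLift.id rfl)
    simpa using e
  map_comp r s := extendMap_comp G hG r s

theorem inclusion_comp_extend (G : (CatOver.{v} X)ᵒᵖ ⥤ M)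
    (hG : (initialMorphisms X).op.IsInvertedBy G) : inclusion X ⋙ extend G hG = G := by
  refine CategoryTheory.Functor.ext (fun _ => rfl) fun P Q f => ?_
  have e := map_comp_extendMap G hG ((inclusion X).map f) (𝟙 _) f.unop (𝟙 f.unop.functor)
    (fun k => isHomLift_eqToHom_app f.unop.w k rfl)
  refine Eq.trans ?_ ((Category.id_comp _).trans (Category.comp_id _)).symm
  exact (Category.id_comp _).symm.trans
    ((congrArg (· ≫ extendMap G hG _) (G.map_id (op P.unop)).symm).trans e)

theorem extend_congr {G G' : (CatOver.{v} X)ᵒᵖ ⥤ M} (h : G = G')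
    (hG : (initialMorphisms X).op.IsInvertedBy G) (hG' : (initialMorphisms X).op.IsInvertedBy G') :
    extend G hG = extend G' hG' := by
  subst h
  rfl

end Extend

/-! ### 2-cells become equalities -/

section TwoCells

variable {M : Type u₁} [Category.{v₁} M]

/-- The two ends of the cylinder, which is the collage of an identity, are identified, since the
extension preserves identities. -/
theorem map_collageInl_id_eq (G : (CatOver.{v} X)ᵒᵖ ⥤ M)
    (hG : (initialMorphisms X).op.IsInvertedBy G) (P : DiagLeft.{v} X) :
    G.map (DiagLeft.collageInl (𝟙 P)).op = G.map (DiagLeft.collageInr (𝟙 P)).op := by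
  have := collageInl_comp_extendMap G hG (𝟙 P)
  rw [show extendMap G hG (𝟙 P) = 𝟙 _ from (extend G hG).map_id P] at this
  exact (Category.comp_id _).symm.trans this

/-- Morphisms of diagrams related by a 2-cell are identified by every functor that inverts initial
functors. -/
theorem map_eq_of_two_cell (F : DiagLeft.{v} X ⥤ M)
    (hF : (initialMorphisms X).op.IsInvertedBy (inclusion X ⋙ F)) {P Q : DiagLeft.{v} X}
    (r s : P ⟶ Q) (α : r.functor ⟶ s.functor)
    (hα : ∀ k, P.diagram.map (α.app k) ≫ s.trans.app k = r.trans.app k) : F.map r = F.map s := by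
  let C : DiagLeft.{v} X := (inclusion X).obj (op (DiagLeft.collage (𝟙 Q)))
  -- the 2-cell, as a homotopy from `r` to `s`
  let h : P ⟶ C := DiagLeft.Hom.mk (Collage.desc r.functor s.functor α)
    { app := fun c => match c with
        | .left k => r.trans.app k
        | .right k => s.trans.app k
      naturality := fun a b f => by
        cases a <;> cases b
        · exact r.trans.naturality f
        · change P.diagram.map (r.functor.map f ≫ α.app _) ≫ s.trans.app _ =
            r.trans.app _ ≫ Q.diagram.map f ≫ 𝟙 _
          rw [Functor.map_comp, Category.assoc, hα, Category.comp_id]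
          exact r.trans.naturality f
        · exact PEmpty.elim f
        · exact s.trans.naturality f }
  let i₁ : C ⟶ Q := (inclusion X).map (DiagLeft.collageInl (𝟙 Q)).op
  let i₂ : C ⟶ Q := (inclusion X).map (DiagLeft.collageInr (𝟙 Q)).op
  have hr : h ≫ i₁ = r := by
    refine DiagLeft.Hom.ext rfl (heq_of_eq ?_)
    ext k
    exact (DiagLeft.comp_trans_app _ _ k).trans (Category.comp_id _)
  have hs : h ≫ i₂ = s := by
    refine DiagLeft.Hom.ext rfl (heq_of_eq ?_)
    ext k
    exact (DiagLeft.comp_trans_app _ _ k).trans (Category.comp_id _)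
  have e : F.map i₁ = F.map i₂ :=
    map_collageInl_id_eq (inclusion X ⋙ F) hF Q
  rw [← hr, ← hs, F.map_comp, F.map_comp, e]

/-- A functor on diagrams that inverts initial functors is the extension of its restriction: in
`Diag←(X)`, the inclusion of the domain of `r` into the collage followed by `r` differs from the
inclusion of the codomain by a 2-cell. -/
theorem extend_inclusion_comp (F : DiagLeft.{v} X ⥤ M)
    (hF : (initialMorphisms X).op.IsInvertedBy (inclusion X ⋙ F)) :
    extend (inclusion X ⋙ F) hF = F := by
  refine CategoryTheory.Functor.ext (fun _ => rfl) fun P Q r => ?_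
  have e1 := collageInl_comp_extendMap (inclusion X ⋙ F) hF r
  let C : DiagLeft.{v} X := (inclusion X).obj (op (DiagLeft.collage r))
  let i₁ : C ⟶ P := (inclusion X).map (DiagLeft.collageInl r).op
  let i₂ : C ⟶ Q := (inclusion X).map (DiagLeft.collageInr r).op
  have e2 : F.map i₁ ≫ F.map r = F.map i₂ := by
    rw [← F.map_comp]
    refine map_eq_of_two_cell F hF _ _ (Collage.cell r.functor) fun k => ?_
    rw [DiagLeft.comp_trans_app]
    exact (Category.comp_id _).trans
      ((DiagLeft.collage_diagram_map_cell r k).trans (Category.id_comp _).symm)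
  have : IsIso ((inclusion X ⋙ F).map (DiagLeft.collageInl r).op) :=
    hF _ (DiagLeft.initialMorphisms_collageInl r)
  refine Eq.trans ?_ ((Category.id_comp _).trans (Category.comp_id _)).symm
  exact (cancel_epi ((inclusion X ⋙ F).map (DiagLeft.collageInl r).op)).1 (e1.trans e2.symm)

/-- The extension of a functor from `(Cat/X)ᵒᵖ` to diagrams is unique. -/
theorem functor_ext_of_inclusion_comp {F F' : DiagLeft.{v} X ⥤ M}
    (hF : (initialMorphisms X).op.IsInvertedBy (inclusion X ⋙ F))
    (e : inclusion X ⋙ F = inclusion X ⋙ F') : F = F' :=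
  have hF' : (initialMorphisms X).op.IsInvertedBy (inclusion X ⋙ F') := e ▸ hF
  (extend_inclusion_comp F hF).symm.trans
    ((extend_congr e hF hF').trans (extend_inclusion_comp F' hF'))

end TwoCells

end

/-! ### Weak equivalences -/

section

variable {X : Type u} [Category.{v} X]

section WeakEquivalences

variable {A : Type u₁} [Category.{v₁} A] {π : A ⥤ X}

/-- A morphism of `Cat/X` acts on lifts by restriction. -/
theorem transport_inclusion_map (hπ : IsDiscreteOpfibration π) {P Q : CatOver.{v} X} (f : P ⟶ Q)
    (L : Lift Q.diagram π) :
    transport hπ f.functor (eqToHom f.w) L =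
      ⟨f.functor ⋙ L.1, by rw [Functor.assoc, L.2, f.w]⟩ := by
  refine transport_eq hπ _ _ _ _ (𝟙 _) fun k => ?_
  exact isHomLift_eqToHom_app f.w k (Functor.congr_obj L.2 _)

/-- The collage of `r` relates restriction along its two inclusions by the action of `r` on
lifts. -/
theorem transport_collageInr (hπ : IsDiscreteOpfibration π) {P Q : DiagLeft.{v} X} (r : P ⟶ Q)
    (L : Lift (DiagLeft.collage r).diagram π) :
    transport hπ (DiagLeft.collageInr r).functor (eqToHom (DiagLeft.collageInr r).w) L =
      transport hπ r.functor r.trans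
        (transport hπ (DiagLeft.collageInl r).functor (eqToHom (DiagLeft.collageInl r).w) L) := by
  refine (transport_inclusion_map hπ (DiagLeft.collageInr r) L).trans (Eq.trans ?_
    (congrArg (transport hπ r.functor r.trans)
      (transport_inclusion_map hπ (DiagLeft.collageInl r) L).symm))
  refine (transport_eq hπ _ _ _ _ (Functor.whiskerRight (Collage.cell r.functor) L.1)
    fun k => ?_).symm
  have h := isHomLift_map_of_comp_eq L.2 ((Collage.cell r.functor).app k)
  have e := DiagLeft.collage_diagram_map_cell r k
  rwa [e] at h

end WeakEquivalences

/-- A morphism of `Cat/X` is a weak equivalence if and only if it is left orthogonal to the discrete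
opfibrations over `X`, for squares whose base is the given diagram. -/
theorem weakEquivalences_inclusion_map_iff {P Q : CatOver.{v} X} (f : P ⟶ Q) :
    weakEquivalences X ((inclusion X).map f.op) ↔
      ∀ (A : Type (max u v)) [Category.{v} A] (π : A ⥤ X), IsDiscreteOpfibration π →
        ∀ L : P.shape ⥤ A, L ⋙ π = P.diagram →
          ∃! M : Q.shape ⥤ A, M ⋙ π = Q.diagram ∧ f.functor ⋙ M = L := by
  refine forall_congr' fun A => forall_congr' fun _ => forall_congr' fun π =>
    forall_congr' fun hπ => ?_
  rw [Function.bijective_iff_existsUnique]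
  constructor
  · intro h L hL
    obtain ⟨M, hM, hu⟩ := h ⟨L, hL⟩
    refine ⟨M.1, ⟨M.2, ?_⟩, ?_⟩
    · exact congrArg Subtype.val ((transport_inclusion_map hπ f M).symm.trans hM)
    · rintro N ⟨hN, rfl⟩
      exact congrArg Subtype.val (hu ⟨N, hN⟩ (transport_inclusion_map hπ f ⟨N, hN⟩))
  · rintro h ⟨L, hL⟩
    obtain ⟨M, ⟨hM, hM'⟩, hu⟩ := h L hL
    refine ⟨⟨M, hM⟩, (transport_inclusion_map hπ f ⟨M, hM⟩).trans (Subtype.ext hM'), ?_⟩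
    rintro ⟨N, hN⟩ hN'
    exact Subtype.ext (hu N ⟨hN, congrArg Subtype.val
      ((transport_inclusion_map hπ f ⟨N, hN⟩).symm.trans hN')⟩)

theorem weakEquivalences_inclusion_map_of_initial {P Q : CatOver.{v} X} (f : P ⟶ Q)
    (hf : initialMorphisms X f) : weakEquivalences X ((inclusion X).map f.op) := by
  rw [weakEquivalences_inclusion_map_iff]
  intro A _ π hπ L hL
  have : f.functor.Initial := hf
  exact hπ.existsUnique_extension f.functor Q.diagram L (hL.trans f.w.symm)

theorem weakEquivalences_collageInr {P Q : DiagLeft.{v} X} (r : P ⟶ Q)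
    (hr : weakEquivalences X r) :
    weakEquivalences X ((inclusion X).map (DiagLeft.collageInr r).op) := by
  intro A _ π hπ
  have h := weakEquivalences_inclusion_map_of_initial (DiagLeft.collageInl r)
    (DiagLeft.initialMorphisms_collageInl r) A π hπ
  exact (congrArg Function.Bijective (funext fun L => transport_collageInr hπ r L)).mpr
    ((hr A π hπ).comp h)

/-- If `f : P ⟶ Q` is a weak equivalence, then `P` and `Q` map initially to a common small
category over `X`. Indeed `P` and `Q` have the same comprehensive factorisation. Its total category
may be large, and is replaced by its full subcategory on the image of `Q`. -/
theorem exists_initial_of_weakEquivalences {P Q : CatOver.{v} X} (f : P ⟶ Q)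
    (hf : weakEquivalences X ((inclusion X).map f.op)) :
    ∃ (T : CatOver.{v} X) (h : Q ⟶ T), initialMorphisms X h ∧ initialMorphisms X (f ≫ h) := by
  rw [weakEquivalences_inclusion_map_iff] at hf
  let ηP := toElements P.diagram
  let ηQ := toElements Q.diagram
  let πP := CategoryOfElements.π (componentsCopresheaf P.diagram)
  let πQ := CategoryOfElements.π (componentsCopresheaf Q.diagram)
  have hπP : IsDiscreteOpfibration πP := isDiscreteOpfibration_elements _
  have hπQ : IsDiscreteOpfibration πQ := isDiscreteOpfibration_elements _
  obtain ⟨h, ⟨hh, fh⟩, -⟩ := hf _ πP hπP ηP rfl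
  obtain ⟨h', ⟨hh', ηh'⟩, -⟩ := hπP.existsUnique_extension ηQ πQ h hh
  obtain ⟨g, ⟨hg, ηg⟩, -⟩ := hπQ.existsUnique_extension ηP πP (f.functor ⋙ ηQ) f.w
  -- `g` and `h'` are mutually inverse, hence `h = ηQ ⋙ h'` is initial
  have gh : g ⋙ h' = 𝟭 _ := by
    refine (hπP.existsUnique_extension ηP πP ηP rfl).unique ⟨?_, ?_⟩ ⟨rfl, rfl⟩
    · rw [Functor.assoc, hh', hg]
    · rw [← Functor.assoc, ηg, Functor.assoc, ηh', fh]
  have hg' : h' ⋙ g = 𝟭 _ := by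
    refine (hπQ.existsUnique_extension ηQ πQ ηQ rfl).unique ⟨?_, ?_⟩ ⟨rfl, rfl⟩
    · rw [Functor.assoc, hg, hh']
    · refine (hf _ πQ hπQ (f.functor ⋙ ηQ) f.w).unique ⟨?_, ?_⟩ ⟨rfl, rfl⟩
      · rw [Functor.assoc, Functor.assoc, hg, hh']
        rfl
      · rw [← Functor.assoc, ← Functor.assoc, Functor.assoc f.functor, ηh', fh, ηg]
  have : h'.IsEquivalence :=
    (CategoryTheory.Equivalence.mk h' g (eqToIso hg'.symm) (eqToIso gh)).isEquivalence_functor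
  have h_initial : h.Initial := by
    rw [← ηh']
    infer_instance
  -- the full subcategory on the image of `h`, indexed by the objects of `Q.shape`, is small
  let ι : InducedCategory _ h.obj ⥤ _ := inducedFunctor h.obj
  let k : Q.shape ⥤ InducedCategory _ h.obj :=
    { obj := fun q => q
      map := fun m => InducedCategory.homMk (h.map m) }
  have hk : k ⋙ ι = h := rfl
  have : (k ⋙ ι).Initial := h_initial
  have : ((f.functor ⋙ k) ⋙ ι).Initial := by
    rw [Functor.assoc, hk, fh]
    infer_instance
  exact ⟨⟨Cat.of (InducedCategory _ h.obj), ι ⋙ πP⟩, CatOver.Hom.mk k hh,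
    Functor.initial_of_comp_full_faithful k ι,
    Functor.initial_of_comp_full_faithful (f.functor ⋙ k) ι⟩

section Inverts

variable {M : Type u₁} [Category.{v₁} M]

theorem isIso_map_of_weakEquivalences (G : (CatOver.{v} X)ᵒᵖ ⥤ M)
    (hG : (initialMorphisms X).op.IsInvertedBy G) {P Q : CatOver.{v} X} (f : P ⟶ Q)
    (hf : weakEquivalences X ((inclusion X).map f.op)) : IsIso (G.map f.op) := by
  obtain ⟨T, h, hh, hfh⟩ := exists_initial_of_weakEquivalences f hf
  have := hG h.op hh
  have := hG (f ≫ h).op hfh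
  rw [op_comp, G.map_comp] at this
  exact IsIso.of_isIso_comp_left (G.map h.op) (G.map f.op)

theorem isInvertedBy_extend (G : (CatOver.{v} X)ᵒᵖ ⥤ M)
    (hG : (initialMorphisms X).op.IsInvertedBy G) :
    (weakEquivalences X).IsInvertedBy (extend G hG) := by
  intro P Q r hr
  have := hG (DiagLeft.collageInl r).op (DiagLeft.initialMorphisms_collageInl r)
  have := isIso_map_of_weakEquivalences G hG (DiagLeft.collageInr r)
    (weakEquivalences_collageInr r hr)
  change IsIso (extendMap G hG r)
  unfold extendMap
  infer_instance

end Inverts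

variable (X)

theorem isInvertedBy_inclusion_comp_Q :
    (initialMorphisms X).op.IsInvertedBy (inclusion X ⋙ (weakEquivalences X).Q) :=
  fun _ _ f hf => (weakEquivalences X).Q_inverts _
    (weakEquivalences_inclusion_map_of_initial f.unop hf)

/-- The comparison of the two localizations is an isomorphism: its inverse is induced by the
extension of the localization functor of `(Cat/X)ᵒᵖ` to diagrams. -/
noncomputable def localizationIsoCat :
    IsoCat (initialMorphisms X).op.Localization (weakEquivalences X).Localization where
  functor := Localization.Construction.lift _ (isInvertedBy_inclusion_comp_Q X)
  inverse := Localization.Construction.lift _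
    (isInvertedBy_extend _ (initialMorphisms X).op.Q_inverts)
  unit_eq := by
    apply Localization.Construction.uniq
    rw [← Functor.assoc, Localization.Construction.fac, Functor.assoc,
      Localization.Construction.fac, inclusion_comp_extend, Functor.comp_id]
  counit_eq := by
    apply Localization.Construction.uniq
    rw [← Functor.assoc, Localization.Construction.fac, Functor.comp_id]
    have e : inclusion X ⋙ (weakEquivalences X).Q =
        inclusion X ⋙ extend _ (initialMorphisms X).op.Q_inverts ⋙
          Localization.Construction.lift _ (isInvertedBy_inclusion_comp_Q X) := by
      rw [← Functor.assoc, inclusion_comp_extend, Localization.Construction.fac]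
    exact (functor_ext_of_inclusion_comp (isInvertedBy_inclusion_comp_Q X) e).symm

end

/-! ### Small bases -/

section

variable {X : Type u} [Category.{v} X]

/-- Discrete opfibrations are local objects for the initial functors. -/
theorem initialMorphisms_le_isLocal :
    initialMorphisms X ≤ (discreteOpfibrations X).isLocal := by
  intro P Q f hf B hB
  have : f.functor.Initial := hf
  have ext := fun g : P ⟶ B =>
    hB.existsUnique_extension f.functor Q.diagram g.functor (g.w.trans f.w.symm)
  constructor
  · intro g g' h
    refine CatOver.Hom.ext ((ext (f ≫ g)).unique ⟨g.w, rfl⟩ ⟨g'.w, ?_⟩)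
    exact congrArg CatOver.Hom.functor h.symm
  · intro g
    obtain ⟨m, ⟨hm, hm'⟩, -⟩ := ext g
    exact ⟨CatOver.Hom.mk m hm, CatOver.Hom.ext hm'⟩

variable (X)

/-- Over a small base, the total category of the comprehensive factorisation of a small diagram is
isomorphic to a small category. -/
theorem exists_initialMorphisms_to_discreteOpfibration [Small.{v} X] (P : CatOver.{v} X) :
    ∃ (S : (discreteOpfibrations X).FullSubcategory) (h : P ⟶ S.obj), initialMorphisms X h := by
  let F := componentsCopresheaf P.diagram
  have : Small.{v} F.Elements := inferInstanceAs (Small.{v} (Σ x : X, F.obj x))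
  let G : InducedCategory F.Elements (equivShrink.{v} F.Elements).symm ⥤ F.Elements :=
    inducedFunctor _
  have : G.IsIso := { bijective_obj := (equivShrink F.Elements).symm.bijective }
  let e := G.asIsomorphism
  have he : e.inverse ⋙ G = 𝟭 _ := e.counit_eq
  have : (toElements P.diagram ⋙ e.inverse).Initial :=
    @Functor.initial_comp_equivalence _ _ _ _ _ _ _ e.inverse _
      e.toEquivalence.isEquivalence_inverse
  refine ⟨⟨⟨Cat.of (InducedCategory F.Elements (equivShrink.{v} F.Elements).symm),
    G ⋙ CategoryOfElements.π F⟩,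
    isDiscreteOpfibration_comp_of_isIso (isDiscreteOpfibration_elements F) G⟩,
    CatOver.Hom.mk (toElements P.diagram ⋙ e.inverse) ?_, ?_⟩
  · change toElements P.diagram ⋙ (e.inverse ⋙ G) ⋙ CategoryOfElements.π F = _
    rw [he]
    rfl
  · exact this

/-- Over a small base, the discrete opfibrations are reflective in `Cat/X`, with initial units. -/
theorem exists_adjunction_discreteOpfibrations_ι [Small.{v} X] :
    ∃ (R : CatOver.{v} X ⥤ (discreteOpfibrations X).FullSubcategory)
      (adj : R ⊣ (discreteOpfibrations X).ι), ∀ P, initialMorphisms X (adj.unit.app P) := by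
  choose S η hη using exists_initialMorphisms_to_discreteOpfibration X
  let e : ∀ (P : CatOver.{v} X) (B : (discreteOpfibrations X).FullSubcategory),
      (S P ⟶ B) ≃ (P ⟶ (discreteOpfibrations X).ι.obj B) := fun P B =>
    (discreteOpfibrations X).fullyFaithfulι.homEquiv.trans
      (Equiv.ofBijective (fun g => η P ≫ g) (initialMorphisms_le_isLocal _ (hη P) _ B.property))
  have he : ∀ P B B' (g : B ⟶ B') (h : S P ⟶ B),
      e P B' (h ≫ g) = e P B h ≫ (discreteOpfibrations X).ι.map g :=
    fun P _ _ g h => (Category.assoc (η P) h.hom g.hom).symm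
  refine ⟨_, Adjunction.adjunctionOfEquivLeft e he, fun P => ?_⟩
  have h : (Adjunction.adjunctionOfEquivLeft e he).unit.app P = η P :=
    (Adjunction.adjunctionOfEquivLeft_unit_app e he P).trans (Category.comp_id (η P))
  exact h ▸ hη P

/-- The inverse equivalence is induced by the reflector, which inverts initial functors since the
discrete opfibrations are local objects for these. -/
theorem isEquivalence_op_ι_comp_Q [Small.{v} X] :
    ((discreteOpfibrations X).ι.op ⋙ (initialMorphisms X).op.Q).IsEquivalence := by
  obtain ⟨R, adj, hadj⟩ := exists_adjunction_discreteOpfibrations_ι X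
  let ι := (discreteOpfibrations X).ι
  let L := (initialMorphisms X).op.Q
  have hR : (initialMorphisms X).op.IsInvertedBy R.op := by
    intro P Q f hf
    have : IsIso (R.map f.unop) := by
      rw [← ObjectProperty.isLocal_iff_isIso_map adj]
      rintro _ ⟨B, rfl⟩
      exact initialMorphisms_le_isLocal _ hf _ B.property
    exact inferInstanceAs (IsIso (R.map f.unop).op)
  have hunit : ∀ P : (CatOver.{v} X)ᵒᵖ, IsIso (L.map (adj.unit.app P.unop).op) := fun P =>
    (initialMorphisms X).op.Q_inverts _ (hadj P.unop)
  let E := Localization.Construction.lift R.op hR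
  have hE : L ⋙ E = R.op := Localization.Construction.fac R.op hR
  let unitIso : R.op ⋙ ι.op ⋙ L ≅ L :=
    NatIso.ofComponents (fun P => asIso (L.map (adj.unit.app P.unop).op)) fun {P Q} f => by
      change L.map _ ≫ L.map _ = L.map _ ≫ L.map _
      rw [← L.map_comp, ← L.map_comp]
      exact congrArg (fun g => L.map (Quiver.Hom.op g)) (adj.unit.naturality f.unop).symm
  let counit : (ι.op ⋙ L) ⋙ E ≅ 𝟭 _ :=
    eqToIso (congrArg (ι.op ⋙ ·) hE) ≪≫ (NatIso.op (asIso adj.counit)).symm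
  let unit : E ⋙ ι.op ⋙ L ≅ 𝟭 _ :=
    Localization.liftNatIso L (initialMorphisms X).op (R.op ⋙ ι.op ⋙ L) L (E ⋙ ι.op ⋙ L) (𝟭 _)
      (h₁ := ⟨eqToIso (by rw [← Functor.assoc, hE])⟩) unitIso
  exact Functor.IsEquivalence.mk' E counit.symm unit

end

end DiagLoc

theorem mainTheorem1 (X : Type u) [Category.{v} X] :
    (∃ h : (DiagLoc.initialMorphisms X).op.IsInvertedBy
        (DiagLoc.inclusion X ⋙ (DiagLoc.weakEquivalences X).Q),
      ∃ e : IsoCat (DiagLoc.initialMorphisms X).op.Localization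
          (DiagLoc.weakEquivalences X).Localization,
        e.functor = Localization.Construction.lift
          (DiagLoc.inclusion X ⋙ (DiagLoc.weakEquivalences X).Q) h) ∧
    (Small.{v} X →
      ((DiagLoc.discreteOpfibrations X).ι.op ⋙ DiagLoc.inclusion X ⋙
        (DiagLoc.weakEquivalences X).Q).IsEquivalence) := by
  refine ⟨⟨DiagLoc.isInvertedBy_inclusion_comp_Q X, DiagLoc.localizationIsoCat X, rfl⟩, fun _ => ?_⟩
  have := DiagLoc.isEquivalence_op_ι_comp_Q X
  have : (DiagLoc.localizationIsoCat X).functor.IsEquivalence :=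
    (DiagLoc.localizationIsoCat X).toEquivalence.isEquivalence_functor
  have e : DiagLoc.inclusion X ⋙ (DiagLoc.weakEquivalences X).Q =
      (DiagLoc.initialMorphisms X).op.Q ⋙ (DiagLoc.localizationIsoCat X).functor :=
    (Localization.Construction.fac _ (DiagLoc.isInvertedBy_inclusion_comp_Q X)).symm
  rw [e, ← Functor.assoc]
  infer_instance
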